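/- Let $k(n)$, $n\ge 2$, be integers with $1\le k(n)\le n/2$. Let $\Omega(n,k(n))$ be the set of $\eta\in\{0,1\}^{\{1,\dots,n\}}$ with $\sum_x\eta(x)=k(n)$. The simple exclusion process on the complete graph with $n$ vertices and $k(n)$ particles is the discrete-time Markov chain on $\Omega(n,k(n))$ that at each step selects two vertices independently and uniformly at random in $\{1,\dots,n\}$ (possibly the same one) and interchanges their contents. Let $\mu_t^{\xi}$ be its law at time $t$ when started from $\xi$, let $\pi$ be the uniform measure on $\Omega(n,k(n))$, and let $$d^{(n)}(t)=\max_{\xi\in\Omega(n,k(n))}\ \frac12\sum_{\eta\in\Omega(n,k(n))}|\mu_t^{\xi}(\eta)-\pi(\eta)|,$$ where $d^{(n)}(s)$ for a real number $s\ge 0$ means $d^{(n)}(\lfloor s\rfloor)$. (1) If $k(n)/\sqrt n\to\infty$, then for every $\varepsilon>0$ there exists $\beta>0$ such that for all $n\ge 2$ $$d^{(n)}\left(\tfrac14 n\log n+\beta n\right)\le\varepsilon,\qquad d^{(n)}\left(\tfrac14 n\log n-\beta n\right)\ge 1-\varepsilon,$$ where the second inequality is asserted for those $n$ for which $\tfrac14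 n\log n-\beta n\ge 0$ (in particular, for all large $n$). (2) If $k(n)/\sqrt n\to 0$ and $k(n)\to\infty$, then for every $\varepsilon>0$ there exists $\beta>0$ such that for all $n\ge 2$ $$d^{(n)}\left(\tfrac12 n\log k(n)+\beta n\right)\le\varepsilon,\qquad d^{(n)}\left(\tfrac12 n\log k(n)-\beta n\right)\ge 1-\varepsilon,$$ where the second inequality is asserted for those $n$ for which $\tfrac12 n\log k(n)-\beta n\ge 0$ (in particular, for all large $n$). (3) If $k(n)/\sqrt n\to l$ for some $l\in(0,\infty)$, then the conclusions of (1) and of (2) both hold. -/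

import Mathlib

open Filter Topology

noncomputable section

namespace Exclusion

/-- The configurations `η ∈ {0,1}^n` of `k` particles on the `n` vertices of the complete graph. -/
abbrev Config (n k : ℕ) : Type :=
  {η : Fin n → Fin 2 // ∑ x, (η x : ℕ) = k}

/-- The action of the symmetric group on configurations, `(σ.η)(x) = η (σ⁻¹ x)`. -/
def act {n k : ℕ} (σ : Equiv.Perm (Fin n)) (η : Config n k) : Config n k :=
  ⟨fun x => η.1 (σ⁻¹ x), by
    rw [Equiv.sum_comp σ⁻¹ (fun x => (η.1 x : ℕ))]
    exact η.2⟩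

/-- The transition matrix of the simple exclusion process on the complete graph: two vertices
`x`, `y` are selected independently and uniformly at random (they may coincide), and their
contents are interchanged. So `P(η, η')` is the proportion of the `n²` ordered pairs `(x, y)`
for which this interchange turns `η` into `η'`. -/
def transition (n k : ℕ) : Matrix (Config n k) (Config n k) ℝ :=
  Matrix.of fun η η' =>
    ((Finset.univ.filter
      (fun p : Fin n × Fin n => act (Equiv.swap p.1 p.2) η = η')).card : ℝ) / (n : ℝ) ^ 2

/-- The law `μ_t^ξ` at time `t` of the process started from `ξ`. -/
def law (n k t : ℕ) (ξ : Config n k) : Config n k → ℝ :=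
  fun η => (transition n k ^ t) ξ η

/-- The equilibrium measure `π`: the uniform measure on the configurations. -/
def equilibrium (n k : ℕ) : Config n k → ℝ :=
  fun _ => 1 / (Fintype.card (Config n k) : ℝ)

/-- The total variation distance of two measures on a finite set. -/
def tvDist {Ω : Type*} [Fintype Ω] (μ ν : Ω → ℝ) : ℝ :=
  (1 / 2) * ∑ η, |μ η - ν η|

/-- The distance to equilibrium at time `t`, maximized over the (finitely many) initial
configurations. -/
def dist (n k t : ℕ) : ℝ :=
  ⨆ ξ : Config n k, tvDist (law n k t ξ) (equilibrium n k)

/-- The exclusion processes with `n` vertices and `k n` particles have cutoff around the times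
`T n` with a window of order `n`. Real times are replaced by their integer parts, and the
lower bound is about those `n` for which the time in it is not negative. -/
def CutoffAt (k : ℕ → ℕ) (T : ℕ → ℝ) : Prop :=
  ∀ ε : ℝ, 0 < ε → ∃ β : ℝ, 0 < β ∧ ∀ n : ℕ, 2 ≤ n →
    dist n (k n) ⌊T n + β * n⌋₊ ≤ ε ∧
    (0 ≤ T n - β * n → 1 - ε ≤ dist n (k n) ⌊T n - β * n⌋₊)

end Exclusion

end

/-! Upper bounds come from duality: the total variation distance is half the largest difference
between `step^[t] f ξ` and the average of `step^[t] f`, over `|f| ≤ 1`. One step multiplies the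
Lipschitz constant of `f` along interchanges by `1 - 2 / n` (`step_lipschitz`), and any two
configurations are at most `k` interchanges apart. Starting from constant `2`, this gives `k (1 -
2/n)^t` (`dist_le_particles`), small just after `(n/2) log k`.

To reach `(n/4) log n`, of order `n` steps are spent on smoothing first. A reverse Poincaré
inequality bounds the mean squared increment of `step^[s] f` by `2/(s+1)`. The optimal `f` is
invariant under the stabilizer of `ξ`, so an increment at one pair of vertices is shared by many
pairs, and the averaged bound becomes a pointwise one of order `(n/k) s^(-1/2)`
(`StabInvariant.sq_le`). Contracting afterwards gives `n √(2/(s+1)) (1 - 2/n)^t`, where `k` has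
cancelled (`dist_le_smoothing`).

For the lower bound, the centred overlap with `ξ` is an eigenfunction with eigenvalue `1 - 2/n`. Its
second moments, under the law and at equilibrium, feed a Chebyshev argument (`dist_ge`): with `q =
(1 - 2/n)^t`, the distance is near `1` as long as `n q²` and `k q` are both large. The regimes
differ only in which of the two is critical, so boundedness of `k/√n` or of its inverse suffices. -/

noncomputable section

namespace Exclusion

section

variable {n k : ℕ}

/-! ### Configurations and the action of permutations -/

/-- The real-valued occupation number of a vertex. -/
def occ (η : Config n k) (x : Fin n) : ℝ := ((η.1 x : ℕ) : ℝ)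

/-- The interchange of the contents of two vertices. -/
def interchange (p : Fin n × Fin n) (η : Config n k) : Config n k :=
  act (Equiv.swap p.1 p.2) η

theorem occ_eq_zero_or_one (η : Config n k) (x : Fin n) : occ η x = 0 ∨ occ η x = 1 := by
  have h : (η.1 x : ℕ) = 0 ∨ (η.1 x : ℕ) = 1 := by omega
  rcases h with h | h <;> simp [occ, h]

theorem occ_nonneg (η : Config n k) (x : Fin n) : 0 ≤ occ η x := by
  rcases occ_eq_zero_or_one η x with h | h <;> simp [h]

theorem occ_le_one (η : Config n k) (x : Fin n) : occ η x ≤ 1 := by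
  rcases occ_eq_zero_or_one η x with h | h <;> simp [h]

theorem sum_occ (η : Config n k) : ∑ x, occ η x = k := by
  have h := η.2
  simp only [occ]
  exact_mod_cast h

theorem config_ext {η ζ : Config n k} (h : ∀ x, occ η x = occ ζ x) : η = ζ := by
  apply Subtype.ext
  funext x
  apply Fin.ext
  have := h x
  simp only [occ] at this
  exact_mod_cast this

theorem occ_act (σ : Equiv.Perm (Fin n)) (η : Config n k) (x : Fin n) :
    occ (act σ η) x = occ η (σ⁻¹ x) := rfl

theorem occ_interchange (p : Fin n × Fin n) (η : Config n k) (x : Fin n) :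
    occ (interchange p η) x = occ η (Equiv.swap p.1 p.2 x) := by
  simp [interchange, occ_act]

theorem act_act (σ τ : Equiv.Perm (Fin n)) (η : Config n k) :
    act σ (act τ η) = act (σ * τ) η := by
  apply config_ext
  intro x
  simp [occ_act]

theorem interchange_interchange (p : Fin n × Fin n) (η : Config n k) :
    interchange p (interchange p η) = η := by
  apply config_ext
  intro x
  simp [occ_interchange]

theorem interchange_comm (a b : Fin n) (η : Config n k) :
    interchange (a, b) η = interchange (b, a) η := by
  simp [interchange, Equiv.swap_comm]

theorem interchange_act (σ : Equiv.Perm (Fin n)) (x y : Fin n) (η : Config n k) :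
    interchange (σ x, σ y) (act σ η) = act σ (interchange (x, y) η) := by
  simp only [interchange, act_act, Equiv.mul_swap_eq_swap_mul]

theorem interchange_eq_self {a b : Fin n} {η : Config n k} (h : occ η a = occ η b) :
    interchange (a, b) η = η := by
  apply config_ext
  intro x
  rw [occ_interchange]
  by_cases ha : x = a
  · subst ha; simp [h]
  by_cases hb : x = b
  · subst hb; simp [h]
  rw [Equiv.swap_apply_of_ne_of_ne ha hb]

/-! ### The number of common particles -/

/-- The number of particles that two configurations have in common. -/
def overlap (ξ η : Config n k) : ℝ := ∑ x, occ ξ x * occ η x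

theorem overlap_nonneg (ξ η : Config n k) : 0 ≤ overlap ξ η :=
  Finset.sum_nonneg fun x _ => mul_nonneg (occ_nonneg ξ x) (occ_nonneg η x)

theorem overlap_le (ξ η : Config n k) : overlap ξ η ≤ k := by
  rw [← sum_occ ξ]
  exact Finset.sum_le_sum fun x _ => mul_le_of_le_one_right (occ_nonneg ξ x) (occ_le_one η x)

theorem overlap_self (ξ : Config n k) : overlap ξ ξ = k := by
  rw [← sum_occ ξ]
  refine Finset.sum_congr rfl fun x _ => ?_
  rcases occ_eq_zero_or_one ξ x with h | h <;> simp [h]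

theorem overlap_interchange (ξ η : Config n k) (a b : Fin n) :
    overlap ξ (interchange (a, b) η) =
      overlap ξ η - (occ ξ a - occ ξ b) * (occ η a - occ η b) := by
  have key : ∀ z, occ ξ z * occ (interchange (a, b) η) z = occ ξ z * occ η z +
      ((if z = a then occ ξ z * (occ η b - occ η a) else 0) +
        (if z = b then occ ξ z * (occ η a - occ η b) else 0)) := by
    intro z
    rw [occ_interchange]
    by_cases ha : z = a
    · subst ha
      by_cases hb : z = b
      · subst hb; simp
      · simp [hb]; ring
    · by_cases hb : z = b
      · subst hb; simp [ha]; ring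
      · simp [ha, hb, Equiv.swap_apply_of_ne_of_ne ha hb]
  simp only [overlap, key, Finset.sum_add_distrib, Finset.sum_ite_eq', Finset.mem_univ, if_true]
  ring

theorem exists_discrepancy {ξ η : Config n k} (h : η ≠ ξ) :
    ∃ a, occ ξ a = 1 ∧ occ η a = 0 := by
  by_contra! hc
  apply h
  have hle : ∀ x ∈ Finset.univ, occ ξ x ≤ occ η x := by
    intro x _
    rcases occ_eq_zero_or_one ξ x with h1 | h1
    · rw [h1]; exact occ_nonneg η x
    · rcases occ_eq_zero_or_one η x with h2 | h2
      · exact absurd h2 (hc x h1)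
      · rw [h1, h2]
  have := (Finset.sum_eq_sum_iff_of_le hle).1 (by rw [sum_occ, sum_occ])
  exact config_ext fun x => (this x (Finset.mem_univ x)).symm

theorem exists_interchange_overlap {ξ η : Config n k} (h : η ≠ ξ) :
    ∃ p, overlap ξ (interchange p η) = overlap ξ η + 1 := by
  obtain ⟨a, ha, ha'⟩ := exists_discrepancy h
  obtain ⟨b, hb, hb'⟩ := exists_discrepancy (Ne.symm h)
  refine ⟨(a, b), ?_⟩
  rw [overlap_interchange, ha, ha', hb, hb']
  ring

/-! ### The averaging operator -/

/-- The transition matrix as an averaging operator on functions. -/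
def step (f : Config n k → ℝ) (η : Config n k) : ℝ :=
  (∑ p : Fin n × Fin n, f (interchange p η)) / (n : ℝ) ^ 2

theorem transition_mulVec (f : Config n k → ℝ) :
    (transition n k).mulVec f = step f := by
  funext η
  simp only [Matrix.mulVec, dotProduct, transition, Matrix.of_apply, step, div_mul_eq_mul_div,
    ← Finset.sum_div]
  congr 1
  rw [← Finset.sum_fiberwise (Finset.univ : Finset (Fin n × Fin n)) (fun p => interchange p η)]
  refine Finset.sum_congr rfl fun ζ _ => ?_
  rw [Finset.sum_congr rfl (g := fun _ => f ζ), Finset.sum_const, nsmul_eq_mul]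
  · rfl
  · intro p hp
    rw [(Finset.mem_filter.1 hp).2]

theorem transition_pow_mulVec (t : ℕ) (f : Config n k → ℝ) :
    (transition n k ^ t).mulVec f = step^[t] f := by
  induction t generalizing f with
  | zero => simp
  | succ t ih => rw [pow_succ, ← Matrix.mulVec_mulVec, transition_mulVec, ih]; rfl

theorem sum_law_mul (t : ℕ) (ξ : Config n k) (f : Config n k → ℝ) :
    ∑ η, law n k t ξ η * f η = step^[t] f ξ := by
  rw [← transition_pow_mulVec]; rfl

theorem step_mono {f g : Config n k → ℝ} (h : ∀ η, f η ≤ g η) (η : Config n k) :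
    step f η ≤ step g η := by
  unfold step
  gcongr
  exact h _

theorem step_iterate_mono {f g : Config n k → ℝ} (h : ∀ η, f η ≤ g η) (t : ℕ) :
    ∀ η, step^[t] f η ≤ step^[t] g η := by
  induction t generalizing f g with
  | zero => exact h
  | succ t ih => exact ih (step_mono h)

theorem step_const (hn : 0 < n) (c : ℝ) : step (fun _ : Config n k => c) = fun _ => c := by
  funext η
  have : (n : ℝ) ≠ 0 := by positivity
  simp only [step, Finset.sum_const, Finset.card_univ, Fintype.card_prod, Fintype.card_fin,
    nsmul_eq_mul]
  push_cast
  field_simp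

theorem step_linear (a b : ℝ) (f g : Config n k → ℝ) :
    step (fun η => a * f η + b * g η) = fun η => a * step f η + b * step g η := by
  funext η
  simp only [step, Finset.sum_add_distrib, ← Finset.mul_sum]
  ring

theorem step_iterate_const (hn : 0 < n) (c : ℝ) (t : ℕ) :
    step^[t] (fun _ : Config n k => c) = fun _ => c := by
  induction t with
  | zero => rfl
  | succ t ih => rw [Function.iterate_succ_apply, step_const hn, ih]

theorem step_iterate_linear (t : ℕ) (a b : ℝ) (f g : Config n k → ℝ) :
    step^[t] (fun η => a * f η + b * g η) = fun η => a * step^[t] f η + b * step^[t] g η := by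
  induction t generalizing f g with
  | zero => rfl
  | succ t ih => simp only [Function.iterate_succ_apply, step_linear, ih]

/-- Conjugating a transposition by `σ` relabels its two vertices, which preserves the uniform law of
the pair. -/
theorem step_act (σ : Equiv.Perm (Fin n)) (f : Config n k → ℝ) (η : Config n k) :
    step f (act σ η) = step (fun ζ => f (act σ ζ)) η := by
  unfold step
  congr 1
  rw [← Equiv.sum_comp (σ.prodCongr σ)]
  refine Finset.sum_congr rfl fun p _ => ?_
  exact congrArg f (interchange_act σ p.1 p.2 η)

theorem step_iterate_act (σ : Equiv.Perm (Fin n)) (t : ℕ) (f : Config n k → ℝ)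
    (η : Config n k) : step^[t] f (act σ η) = step^[t] (fun ζ => f (act σ ζ)) η := by
  induction t generalizing f with
  | zero => rfl
  | succ t ih =>
    rw [Function.iterate_succ_apply, ih, Function.iterate_succ_apply]
    simp only [step_act]

theorem sum_step (hn : 0 < n) (f : Config n k → ℝ) : ∑ η, step f η = ∑ η, f η := by
  have : (n : ℝ) ≠ 0 := by positivity
  simp only [step, ← Finset.sum_div]
  rw [Finset.sum_comm]
  have h : ∀ p : Fin n × Fin n, ∑ η : Config n k, f (interchange p η) = ∑ η, f η := fun p =>
    Equiv.sum_comp (Function.Involutive.toPerm (interchange p) (interchange_interchange p)) f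
  simp only [h, Finset.sum_const, Finset.card_univ, Fintype.card_prod, Fintype.card_fin,
    nsmul_eq_mul]
  push_cast
  field_simp

theorem sum_step_iterate (hn : 0 < n) (f : Config n k → ℝ) (t : ℕ) :
    ∑ η, step^[t] f η = ∑ η, f η := by
  induction t generalizing f with
  | zero => rfl
  | succ t ih => rw [Function.iterate_succ_apply, ih, sum_step hn]

/-! ### Contraction of the Lipschitz constant -/

theorem sum_fin_split {a b : Fin n} (hab : a ≠ b) (u : Fin n → ℝ) :
    ∑ x, u x = u a + u b + ∑ x ∈ Finset.univ \ {a, b}, u x := by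
  rw [← Finset.sum_sdiff (Finset.subset_univ {a, b}), Finset.sum_pair hab]
  ring

theorem card_sdiff_pair {a b : Fin n} (hab : a ≠ b) :
    (((Finset.univ \ {a, b} : Finset (Fin n)).card : ℕ) : ℝ) = n - 2 := by
  have h := Finset.card_sdiff_add_card_eq_card (Finset.subset_univ ({a, b} : Finset (Fin n)))
  rw [Finset.card_pair hab, Finset.card_univ, Fintype.card_fin] at h
  have h' : (((Finset.univ \ {a, b} : Finset (Fin n)).card : ℕ) : ℝ) + 2 = n := by
    exact_mod_cast h
  linarith

/-- Of the `n²` pairs, those inside `{a, b}` cancel in total, and of the two pairs joining `a` and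
`b` to an outside vertex only one contributes. This leaves `2(n-2) + (n-2)² = n(n-2)` terms of size
at most `L`. -/
theorem step_lipschitz (hn : 2 ≤ n) {h : Config n k → ℝ} {L : ℝ}
    (hL : ∀ p η, |h (interchange p η) - h η| ≤ L) (p : Fin n × Fin n) (η : Config n k) :
    |step h (interchange p η) - step h η| ≤ L * (1 - 2 / n) := by
  obtain ⟨a, b⟩ := p
  have hn0 : (0 : ℝ) < n := by positivity
  have hn2 : (2 : ℝ) ≤ n := by exact_mod_cast hn
  have hL0 : 0 ≤ L := (abs_nonneg _).trans (hL (a, b) η)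
  by_cases hocc : occ η a = occ η b
  · rw [interchange_eq_self hocc]
    simp only [sub_self, abs_zero]
    have : (2 : ℝ) / n ≤ 1 := by rw [div_le_one hn0]; exact hn2
    exact mul_nonneg hL0 (by linarith)
  have hab : a ≠ b := fun e => hocc (by rw [e])
  set D : Fin n → Fin n → ℝ := fun x y =>
    h (interchange (a, b) (interchange (x, y) η)) - h (interchange (x, y) η) with hD
  have hDL : ∀ x y, |D x y| ≤ L := fun x y => hL _ _
  have hsum : step h (interchange (a, b) η) - step h η = (∑ x, ∑ y, D x y) / (n : ℝ) ^ 2 := by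
    have e : step h (interchange (a, b) η) = step (fun ζ => h (interchange (a, b) ζ)) η :=
      step_act _ _ _
    rw [e]
    simp only [step, hD, ← sub_div, ← Finset.sum_sub_distrib, Fintype.sum_prod_type]
  have hzero : ∀ x y, occ (interchange (x, y) η) a = occ (interchange (x, y) η) b →
      D x y = 0 := fun x y e => by simp only [hD]; rw [interchange_eq_self e, sub_self]
  have hsymm : ∀ x y, D x y = D y x := fun x y => by simp only [hD, interchange_comm x y]
  -- The content of `y` agrees with that of `a` or of `b`; bringing it to the other vertex equalizes
  -- `a` and `b`, which kills that term.
  have hpair : ∀ y ∈ Finset.univ \ {a, b}, |D a y + D b y| ≤ L := by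
    intro y hy
    simp only [Finset.mem_sdiff, Finset.mem_univ, Finset.mem_insert, Finset.mem_singleton,
      true_and, not_or] at hy
    by_cases hya : occ η y = occ η b
    · rw [hzero a y, zero_add]
      · exact hDL b y
      · rw [occ_interchange, occ_interchange]
        simp only [Equiv.swap_apply_left]
        rw [Equiv.swap_apply_of_ne_of_ne hab.symm (Ne.symm hy.2), hya]
    · have hyb : occ η y = occ η a := by
        rcases occ_eq_zero_or_one η y with h1 | h1 <;>
        rcases occ_eq_zero_or_one η a with h2 | h2 <;>
        rcases occ_eq_zero_or_one η b with h3 | h3 <;> simp_all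
      rw [hzero b y, add_zero]
      · exact hDL a y
      · rw [occ_interchange, occ_interchange]
        simp only [Equiv.swap_apply_left]
        rw [Equiv.swap_apply_of_ne_of_ne hab (Ne.symm hy.1), hyb]
  have hdiag : D a a + D a b + (D b a + D b b) = 0 := by
    have h1 : ∀ x : Fin n, interchange (x, x) η = η := fun x => interchange_eq_self rfl
    simp only [hD, h1, interchange_comm b a, interchange_interchange]
    ring
  set R : Finset (Fin n) := Finset.univ \ {a, b} with hR
  have hcard : (R.card : ℝ) = n - 2 := card_sdiff_pair hab
  have hsplit : ∑ x, ∑ y, D x y = ∑ y ∈ R, (D a y + D b y) +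
      (∑ x ∈ R, (D a x + D b x) + ∑ x ∈ R, ∑ y ∈ R, D x y) := by
    rw [sum_fin_split hab, sum_fin_split hab (D a), sum_fin_split hab (D b)]
    simp only [sum_fin_split hab (D _), Finset.sum_add_distrib]
    have e1 : ∑ x ∈ R, D x a = ∑ x ∈ R, D a x := Finset.sum_congr rfl fun x _ => hsymm x a
    have e2 : ∑ x ∈ R, D x b = ∑ x ∈ R, D b x := Finset.sum_congr rfl fun x _ => hsymm x b
    linarith
  have hb1 : |∑ y ∈ R, (D a y + D b y)| ≤ (n - 2) * L := by
    rw [← hcard, ← nsmul_eq_mul]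
    exact (Finset.abs_sum_le_sum_abs _ _).trans (Finset.sum_le_card_nsmul _ _ _ hpair)
  have hb2 : |∑ x ∈ R, ∑ y ∈ R, D x y| ≤ (n - 2) * ((n - 2) * L) := by
    rw [← hcard, ← nsmul_eq_mul, ← nsmul_eq_mul]
    refine (Finset.abs_sum_le_sum_abs _ _).trans (Finset.sum_le_card_nsmul _ _ _ fun x _ => ?_)
    exact (Finset.abs_sum_le_sum_abs _ _).trans
      (Finset.sum_le_card_nsmul _ _ _ fun y _ => hDL x y)
  rw [hsum, abs_div, abs_of_pos (by positivity : (0 : ℝ) < (n : ℝ) ^ 2), div_le_iff₀ (by positivity),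
    hsplit]
  have e : L * (1 - 2 / n) * (n : ℝ) ^ 2 = (n - 2) * L + ((n - 2) * L + (n - 2) * ((n - 2) * L)) := by
    field_simp
    ring
  rw [e]
  exact (abs_add_le _ _).trans (add_le_add hb1 ((abs_add_le _ _).trans (add_le_add hb1 hb2)))

theorem step_iterate_lipschitz (hn : 2 ≤ n) {h : Config n k → ℝ} {L : ℝ}
    (hL : ∀ p η, |h (interchange p η) - h η| ≤ L) (t : ℕ) :
    ∀ p η, |step^[t] h (interchange p η) - step^[t] h η| ≤ L * (1 - 2 / n) ^ t := by
  induction t with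
  | zero => simpa using hL
  | succ t ih =>
    intro p η
    rw [Function.iterate_succ_apply', pow_succ, ← mul_assoc]
    exact step_lipschitz hn ih p η

/-- Each interchange that moves a misplaced particle to a missing site raises the overlap by one,
and the overlap cannot exceed `k`. -/
theorem abs_sub_le_of_lipschitz (hn : 0 < n) {h : Config n k → ℝ} {L : ℝ}
    (hL : ∀ p η, |h (interchange p η) - h η| ≤ L) (η ξ : Config n k) :
    |h η - h ξ| ≤ L * k := by
  have key : ∀ m : ℕ, ∀ η, (k : ℝ) ≤ overlap ξ η + m → |h η - h ξ| ≤ L * m := by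
    intro m
    induction m with
    | zero =>
      intro η hη
      by_cases hne : η = ξ
      · simp [hne]
      · obtain ⟨p, hp⟩ := exists_interchange_overlap hne
        have := overlap_le ξ (interchange p η)
        push_cast at hη
        linarith
    | succ m ih =>
      intro η hη
      push_cast at hη ⊢
      by_cases hne : η = ξ
      · rw [hne, sub_self, abs_zero]
        have := (abs_nonneg _).trans (hL (⟨0, hn⟩, ⟨0, hn⟩) η)
        positivity
      · obtain ⟨p, hp⟩ := exists_interchange_overlap hne
        have h1 := ih (interchange p η) (by rw [hp]; linarith)
        have h2 := hL p η
        rw [abs_sub_comm] at h2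
        calc |h η - h ξ| ≤ |h η - h (interchange p η)| + |h (interchange p η) - h ξ| :=
              abs_sub_le _ _ _
          _ ≤ L * (m + 1) := by linarith
  exact key k η (by linarith [overlap_nonneg ξ η])

/-! ### The carré du champ and its decay -/

/-- The mean squared increment of a function along a random interchange. -/
def gam (f : Config n k → ℝ) (η : Config n k) : ℝ :=
  (∑ p : Fin n × Fin n, (f (interchange p η) - f η) ^ 2) / (n : ℝ) ^ 2

theorem gam_nonneg (f : Config n k → ℝ) (η : Config n k) : 0 ≤ gam f η := by
  unfold gam
  positivity

/-- Averaging commutes with interchanges in the sense of `step_act`, so this is Cauchy–Schwarz for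
each fixed pair `q`. -/
theorem gam_step_le (hn : 0 < n) (f : Config n k → ℝ) (η : Config n k) :
    gam (step f) η ≤ step (gam f) η := by
  have hn0 : (0 : ℝ) < n := by positivity
  have h : ∀ q : Fin n × Fin n, (step f (interchange q η) - step f η) ^ 2 ≤
      (∑ p : Fin n × Fin n, (f (interchange q (interchange p η)) - f (interchange p η)) ^ 2) /
        (n : ℝ) ^ 2 := by
    intro q
    have e : step f (interchange q η) = step (fun ζ => f (interchange q ζ)) η := step_act _ _ _
    rw [e]
    simp only [step, ← sub_div, ← Finset.sum_sub_distrib]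
    rw [div_pow, div_le_div_iff₀ (by positivity) (by positivity)]
    have := sq_sum_le_card_mul_sum_sq (s := (Finset.univ : Finset (Fin n × Fin n)))
      (f := fun p => f (interchange q (interchange p η)) - f (interchange p η))
    rw [Finset.card_univ, Fintype.card_prod, Fintype.card_fin] at this
    push_cast at this
    calc _ ≤ _ := mul_le_mul_of_nonneg_right this (by positivity : (0 : ℝ) ≤ (n : ℝ) ^ 2)
      _ = _ := by ring
  calc gam (step f) η ≤ (∑ q : Fin n × Fin n, (∑ p : Fin n × Fin n,
        (f (interchange q (interchange p η)) - f (interchange p η)) ^ 2) / (n : ℝ) ^ 2) /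
        (n : ℝ) ^ 2 := by
        unfold gam
        gcongr with q
        exact h q
    _ = step (gam f) η := by
        simp only [step, gam, ← Finset.sum_div]
        rw [Finset.sum_comm]

theorem gam_step_iterate_le (hn : 0 < n) (f : Config n k → ℝ) (s : ℕ) :
    ∀ η, gam (step^[s] f) η ≤ step^[s] (gam f) η := by
  induction s generalizing f with
  | zero => exact fun η => le_rfl
  | succ s ih =>
    intro η
    rw [Function.iterate_succ_apply, Function.iterate_succ_apply]
    exact (ih (step f) η).trans (step_iterate_mono (gam_step_le hn f) s η)

theorem occ_sub_sq_sq (η : Config n k) (x y : Fin n) :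
    ((occ η x - occ η y) ^ 2) ^ 2 = occ η x + occ η y - 2 * (occ η x * occ η y) := by
  rcases occ_eq_zero_or_one η x with h1 | h1 <;> rcases occ_eq_zero_or_one η y with h2 | h2 <;>
    rw [h1, h2] <;> norm_num

/-- A random interchange changes the configuration with probability at most `2k(n-k)/n² ≤ 1/2`, so
by Cauchy–Schwarz the squared mean increment is at most half the mean squared increment. -/
theorem half_gam_le_variance (hn : 0 < n) (f : Config n k → ℝ) (η : Config n k) :
    1 / 2 * gam f η ≤ step (fun ζ => f ζ ^ 2) η - step f η ^ 2 := by
  have hn0 : (0 : ℝ) < n := by positivity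
  set Z : Fin n × Fin n → ℝ := fun p => f (interchange p η) - f η with hZ
  -- The indicator that the two contents differ; it contains the support of `Z`.
  set w : Fin n × Fin n → ℝ := fun p => (occ η p.1 - occ η p.2) ^ 2 with hw
  have hZw : ∀ p, Z p * w p = Z p := by
    rintro ⟨x, y⟩
    by_cases h : occ η x = occ η y
    · simp [hZ, interchange_eq_self h]
    · have : w (x, y) = 1 := by
        simp only [hw]
        rcases occ_eq_zero_or_one η x with h1 | h1 <;>
          rcases occ_eq_zero_or_one η y with h2 | h2 <;> simp_all
      rw [this, mul_one]
  have hw2 : ∑ p, w p ^ 2 ≤ (n : ℝ) ^ 2 / 2 := by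
    have : ∑ p, w p ^ 2 = 2 * (n * k) - 2 * (k * k : ℝ) := by
      simp only [hw, occ_sub_sq_sq, Fintype.sum_prod_type, Finset.sum_sub_distrib,
        Finset.sum_add_distrib, ← Finset.mul_sum, ← Finset.sum_mul, sum_occ, Finset.sum_const,
        Finset.card_univ, Fintype.card_fin, nsmul_eq_mul]
      ring
    rw [this]
    nlinarith [sq_nonneg ((n : ℝ) - 2 * k)]
  have hcs : (∑ p, Z p) ^ 2 ≤ (∑ p, Z p ^ 2) * ((n : ℝ) ^ 2 / 2) := by
    have := Finset.sum_mul_sq_le_sq_mul_sq Finset.univ Z w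
    simp only [hZw] at this
    exact this.trans (mul_le_mul_of_nonneg_left hw2 (Finset.sum_nonneg fun p _ => sq_nonneg _))
  have hf : ∀ p, f (interchange p η) = f η + Z p := fun p => by simp only [hZ]; ring
  have e1 : step f η = f η + (∑ p, Z p) / (n : ℝ) ^ 2 := by
    simp only [step, hf, Finset.sum_add_distrib, Finset.sum_const, Finset.card_univ,
      Fintype.card_prod, Fintype.card_fin, nsmul_eq_mul]
    push_cast
    field_simp
  have e2 : step (fun ζ => f ζ ^ 2) η =
      f η ^ 2 + 2 * f η * ((∑ p, Z p) / (n : ℝ) ^ 2) + (∑ p, Z p ^ 2) / (n : ℝ) ^ 2 := by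
    simp only [step, hf, add_sq, Finset.sum_add_distrib, Finset.sum_const, Finset.card_univ,
      Fintype.card_prod, Fintype.card_fin, nsmul_eq_mul, ← Finset.mul_sum]
    push_cast
    field_simp
  have e3 : gam f η = (∑ p, Z p ^ 2) / (n : ℝ) ^ 2 := rfl
  rw [e1, e2, e3]
  have : ((∑ p, Z p) / (n : ℝ) ^ 2) ^ 2 ≤ 1 / 2 * ((∑ p, Z p ^ 2) / (n : ℝ) ^ 2) := by
    rw [div_pow, div_le_iff₀ (by positivity)]
    calc _ ≤ _ := hcs
      _ = _ := by field_simp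
  linarith

/-- The variance after `s + 1` steps telescopes into one-step variances. Each contributes at least
half of `gam (step^[s] f)`, because `gam` decays along the semigroup. -/
theorem reverse_poincare (hn : 0 < n) (s : ℕ) (f : Config n k → ℝ) (η : Config n k) :
    step^[s + 1] f η ^ 2 + (s + 1) / 2 * gam (step^[s] f) η ≤
      step^[s + 1] (fun ζ => f ζ ^ 2) η := by
  induction s generalizing f with
  | zero =>
    have := half_gam_le_variance hn f η
    simp only [zero_add, Function.iterate_one, Nat.cast_zero, Function.iterate_zero, id]
    linarith
  | succ s ih =>
    have h1 : ∀ ζ, 1 * step f ζ ^ 2 + 1 / 2 * gam f ζ ≤ step (fun ζ => f ζ ^ 2) ζ := fun ζ => by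
      linarith [half_gam_le_variance hn f ζ]
    have h2 := step_iterate_mono h1 (s + 1) η
    rw [step_iterate_linear] at h2
    have h3 := ih (step f)
    have h4 := gam_step_iterate_le hn f (s + 1) η
    rw [Function.iterate_succ_apply step (s + 1) f,
      Function.iterate_succ_apply step (s + 1) (fun ζ => f ζ ^ 2)]
    rw [Function.iterate_succ_apply step s f] at h4 ⊢
    push_cast
    linarith

theorem gam_step_iterate_le_of_abs_le_one (hn : 0 < n) {f : Config n k → ℝ}
    (hf : ∀ η, |f η| ≤ 1) (s : ℕ) (η : Config n k) : gam (step^[s] f) η ≤ 2 / (s + 1) := by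
  have h1 := reverse_poincare hn s f η
  have h2 : step^[s + 1] (fun ζ => f ζ ^ 2) η ≤ step^[s + 1] (fun _ => (1 : ℝ)) η :=
    step_iterate_mono (fun ζ => (sq_le_one_iff_abs_le_one _).2 (hf ζ)) _ η
  rw [step_iterate_const hn] at h2
  rw [le_div_iff₀ (by positivity)]
  nlinarith [sq_nonneg (step^[s + 1] f η)]

/-! ### Functions invariant under the stabilizer of a configuration -/

/-- Invariance of a function under the permutations that fix `ξ`. -/
def StabInvariant (ξ : Config n k) (h : Config n k → ℝ) : Prop :=
  ∀ σ : Equiv.Perm (Fin n), act σ ξ = ξ → ∀ η, h (act σ η) = h η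

theorem StabInvariant.step_iterate {ξ : Config n k} {h : Config n k → ℝ}
    (hh : StabInvariant ξ h) (t : ℕ) : StabInvariant ξ (step^[t] h) := by
  intro σ hσ η
  rw [step_iterate_act]
  simp only [hh σ hσ]

/-- The permutation `(a x)(b y)` fixes both `ξ` and `η` and conjugates the transposition `(a b)`
into `(x y)`. -/
theorem StabInvariant.interchange_eq {ξ : Config n k} {h : Config n k → ℝ}
    (hh : StabInvariant ξ h) {η : Config n k} {a b x y : Fin n} (hab : occ η a ≠ occ η b)
    (hηx : occ η x = occ η a) (hξx : occ ξ x = occ ξ a) (hηy : occ η y = occ η b)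
    (hξy : occ ξ y = occ ξ b) : h (interchange (x, y) η) = h (interchange (a, b) η) := by
  have hξ : act (Equiv.swap a x * Equiv.swap b y) ξ = ξ := by
    rw [← act_act]
    change interchange (a, x) (interchange (b, y) ξ) = ξ
    rw [interchange_eq_self hξy.symm, interchange_eq_self hξx.symm]
  have hη : act (Equiv.swap a x * Equiv.swap b y) η = η := by
    rw [← act_act]
    change interchange (a, x) (interchange (b, y) η) = η
    rw [interchange_eq_self hηy.symm, interchange_eq_self hηx.symm]
  have hne : ∀ {u v : Fin n}, occ η u ≠ occ η v → u ≠ v := fun h e => h (by rw [e])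
  have hσa : (Equiv.swap a x * Equiv.swap b y) a = x := by
    rw [Equiv.Perm.mul_apply, Equiv.swap_apply_of_ne_of_ne (hne hab) (hne (hηy ▸ hab)),
      Equiv.swap_apply_left]
  have hσb : (Equiv.swap a x * Equiv.swap b y) b = y := by
    rw [Equiv.Perm.mul_apply, Equiv.swap_apply_left, Equiv.swap_apply_of_ne_of_ne]
    · exact hne (hηy ▸ hab.symm)
    · exact hne (by rw [hηy, hηx]; exact hab.symm)
  have key := interchange_act (Equiv.swap a x * Equiv.swap b y) a b η
  rw [hσa, hσb, hη] at key
  rw [key, hh _ hξ]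

theorem mul_sq_le_gam {h : Config n k → ℝ} {η : Config n k} {δ : ℝ}
    {u v : Fin n → ℝ} (hn : 0 < n) (hu : ∀ x, u x = 0 ∨ u x = 1) (hv : ∀ x, v x = 0 ∨ v x = 1)
    (huv : ∀ x y, u x = 1 → v y = 1 → h (interchange (x, y) η) - h η = δ) :
    (∑ x, u x) * (∑ y, v y) * δ ^ 2 ≤ (n : ℝ) ^ 2 * gam h η := by
  have hn0 : (n : ℝ) ^ 2 ≠ 0 := by positivity
  rw [gam, mul_div_cancel₀ _ hn0, Finset.sum_mul_sum, Fintype.sum_prod_type, Finset.sum_mul]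
  simp only [Finset.sum_mul]
  refine Finset.sum_le_sum fun x _ => Finset.sum_le_sum fun y _ => ?_
  rcases hu x with h1 | h1
  · rw [h1]; simp only [zero_mul]; positivity
  rcases hv y with h2 | h2
  · rw [h2]; simp only [mul_zero, zero_mul]; positivity
  rw [h1, h2, huv x y h1 h2]
  simp

theorem StabInvariant.gam_lower_agree {ξ : Config n k} {h : Config n k → ℝ} (hn : 0 < n)
    (hh : StabInvariant ξ h) {η : Config n k} {a b : Fin n} (ha : occ η a = 1) (hb : occ η b = 0)
    (ha' : occ ξ a = 1) (hb' : occ ξ b = 0) :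
    overlap ξ η * (n - 2 * k + overlap ξ η) * (h (interchange (a, b) η) - h η) ^ 2 ≤
      (n : ℝ) ^ 2 * gam h η := by
  have key := mul_sq_le_gam (h := h) (η := η) (δ := h (interchange (a, b) η) - h η)
    (u := fun x => occ ξ x * occ η x) (v := fun y => (1 - occ ξ y) * (1 - occ η y)) hn ?_ ?_ ?_
  · have e : ∑ y, (1 - occ ξ y) * (1 - occ η y) = n - 2 * k + overlap ξ η := by
      have : ∀ y, (1 - occ ξ y) * (1 - occ η y) = 1 - occ ξ y - occ η y + occ ξ y * occ η y :=
        fun y => by ring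
      simp only [this, Finset.sum_add_distrib, Finset.sum_sub_distrib, sum_occ, overlap]
      simp
      ring
    rw [e] at key
    exact key
  · intro x
    rcases occ_eq_zero_or_one ξ x with h1 | h1 <;> rcases occ_eq_zero_or_one η x with h2 | h2 <;>
      simp [h1, h2]
  · intro x
    rcases occ_eq_zero_or_one ξ x with h1 | h1 <;> rcases occ_eq_zero_or_one η x with h2 | h2 <;>
      simp [h1, h2]
  · intro x y hx hy
    have hx' : occ η x = 1 ∧ occ ξ x = 1 := by
      rcases occ_eq_zero_or_one ξ x with h1 | h1 <;>
        rcases occ_eq_zero_or_one η x with h2 | h2 <;> simp_all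
    have hy' : occ η y = 0 ∧ occ ξ y = 0 := by
      rcases occ_eq_zero_or_one ξ y with h1 | h1 <;>
        rcases occ_eq_zero_or_one η y with h2 | h2 <;> simp_all
    rw [hh.interchange_eq (a := a) (b := b) (by simp [ha, hb]) (by rw [ha, hx'.1])
      (by rw [ha', hx'.2]) (by rw [hb, hy'.1]) (by rw [hb', hy'.2])]

theorem StabInvariant.gam_lower_disagree {ξ : Config n k} {h : Config n k → ℝ} (hn : 0 < n)
    (hh : StabInvariant ξ h) {η : Config n k} {a b : Fin n} (ha : occ η a = 1) (hb : occ η b = 0)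
    (ha' : occ ξ a = 0) (hb' : occ ξ b = 1) :
    (k - overlap ξ η) * (k - overlap ξ η) * (h (interchange (a, b) η) - h η) ^ 2 ≤
      (n : ℝ) ^ 2 * gam h η := by
  have key := mul_sq_le_gam (h := h) (η := η) (δ := h (interchange (a, b) η) - h η)
    (u := fun x => (1 - occ ξ x) * occ η x) (v := fun y => occ ξ y * (1 - occ η y)) hn ?_ ?_ ?_
  · have e1 : ∑ x, (1 - occ ξ x) * occ η x = k - overlap ξ η := by
      simp only [sub_mul, one_mul, Finset.sum_sub_distrib, sum_occ, overlap]
    have e2 : ∑ y, occ ξ y * (1 - occ η y) = k - overlap ξ η := by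
      simp only [mul_sub, mul_one, Finset.sum_sub_distrib, sum_occ, overlap]
    rw [e1, e2] at key
    exact key
  · intro x
    rcases occ_eq_zero_or_one ξ x with h1 | h1 <;> rcases occ_eq_zero_or_one η x with h2 | h2 <;>
      simp [h1, h2]
  · intro x
    rcases occ_eq_zero_or_one ξ x with h1 | h1 <;> rcases occ_eq_zero_or_one η x with h2 | h2 <;>
      simp [h1, h2]
  · intro x y hx hy
    have hx' : occ η x = 1 ∧ occ ξ x = 0 := by
      rcases occ_eq_zero_or_one ξ x with h1 | h1 <;>
        rcases occ_eq_zero_or_one η x with h2 | h2 <;> simp_all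
    have hy' : occ η y = 0 ∧ occ ξ y = 1 := by
      rcases occ_eq_zero_or_one ξ y with h1 | h1 <;>
        rcases occ_eq_zero_or_one η y with h2 | h2 <;> simp_all
    rw [hh.interchange_eq (a := a) (b := b) (by simp [ha, hb]) (by rw [ha, hx'.1])
      (by rw [ha', hx'.2]) (by rw [hb, hy'.1]) (by rw [hb', hy'.2])]

/-- With overlap at least `k/2`, at least `k²/4` pairs at `η` share the increment. Otherwise the
reverse move, seen from the interchanged configuration, is shared by at least `k²/4` pairs of
discrepancies. -/
theorem StabInvariant.sq_le_of_agree {ξ : Config n k} {h : Config n k → ℝ} {G : ℝ} (hn : 0 < n)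
    (hkn : 2 * k ≤ n) (hh : StabInvariant ξ h) (hG : ∀ η, gam h η ≤ G) {η : Config n k}
    {a b : Fin n} (ha : occ η a = 1) (hb : occ η b = 0) (ha' : occ ξ a = 1) (hb' : occ ξ b = 0) :
    (k : ℝ) ^ 2 / 4 * (h (interchange (a, b) η) - h η) ^ 2 ≤ (n : ℝ) ^ 2 * G := by
  have hkn' : (2 : ℝ) * k ≤ n := by exact_mod_cast hkn
  have hk0 : (0 : ℝ) ≤ k := by positivity
  have hov := overlap_le ξ η
  by_cases hcase : (k : ℝ) / 2 ≤ overlap ξ η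
  · have h1 := hh.gam_lower_agree hn ha hb ha' hb'
    have h2 : (k : ℝ) ^ 2 / 4 ≤ overlap ξ η * (n - 2 * k + overlap ξ η) := by nlinarith
    calc _ ≤ _ := mul_le_mul_of_nonneg_right h2 (sq_nonneg _)
      _ ≤ _ := h1
      _ ≤ _ := by gcongr; exact hG η
  · have h1 := hh.gam_lower_disagree hn (η := interchange (a, b) η) (a := b) (b := a)
      (by simp [occ_interchange, ha]) (by simp [occ_interchange, hb]) hb' ha'
    rw [interchange_comm b a, interchange_interchange, overlap_interchange, ha, hb, ha', hb'] at h1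
    have h2 : (k : ℝ) ^ 2 / 4 ≤ (k - (overlap ξ η - (1 - 0) * (1 - 0))) *
        (k - (overlap ξ η - (1 - 0) * (1 - 0))) := by nlinarith
    calc _ = (k : ℝ) ^ 2 / 4 * (h η - h (interchange (a, b) η)) ^ 2 := by ring
      _ ≤ _ := mul_le_mul_of_nonneg_right h2 (sq_nonneg _)
      _ ≤ _ := h1
      _ ≤ _ := by gcongr; exact hG _

theorem StabInvariant.sq_le {ξ : Config n k} {h : Config n k → ℝ} {G : ℝ} (hn : 0 < n)
    (hkn : 2 * k ≤ n) (hh : StabInvariant ξ h) (hG : ∀ η, gam h η ≤ G) (p : Fin n × Fin n)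
    (η : Config n k) :
    (k : ℝ) ^ 2 / 4 * (h (interchange p η) - h η) ^ 2 ≤ (n : ℝ) ^ 2 * G := by
  have hG0 : 0 ≤ G := (gam_nonneg h η).trans (hG η)
  have htriv : ∀ {q : Fin n × Fin n} {ζ : Config n k}, h (interchange q ζ) = h ζ →
      (k : ℝ) ^ 2 / 4 * (h (interchange q ζ) - h ζ) ^ 2 ≤ (n : ℝ) ^ 2 * G := by
    intro q ζ e
    rw [e, sub_self]
    simp only [ne_eq, OfNat.ofNat_ne_zero, not_false_eq_true, zero_pow, mul_zero]
    positivity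
  have key : ∀ (a b : Fin n) (ζ : Config n k), occ ζ a = 1 → occ ζ b = 0 →
      (k : ℝ) ^ 2 / 4 * (h (interchange (a, b) ζ) - h ζ) ^ 2 ≤ (n : ℝ) ^ 2 * G := by
    intro a b ζ ha hb
    by_cases hξ : occ ξ a = occ ξ b
    · exact htriv (hh _ (interchange_eq_self hξ) ζ)
    rcases occ_eq_zero_or_one ξ a with ha' | ha'
    · have hb' : occ ξ b = 1 := by
        rcases occ_eq_zero_or_one ξ b with h1 | h1
        · exact absurd (ha'.trans h1.symm) hξ
        · exact h1
      have := hh.sq_le_of_agree hn hkn hG (η := interchange (a, b) ζ) (a := b) (b := a)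
        (by simp [occ_interchange, ha]) (by simp [occ_interchange, hb]) hb' ha'
      rw [interchange_comm b a, interchange_interchange] at this
      calc _ = _ := by ring
        _ ≤ _ := this
    · have hb' : occ ξ b = 0 := by
        rcases occ_eq_zero_or_one ξ b with h1 | h1
        · exact h1
        · exact absurd (ha'.trans h1.symm) hξ
      exact hh.sq_le_of_agree hn hkn hG ha hb ha' hb'
  obtain ⟨a, b⟩ := p
  rcases occ_eq_zero_or_one η a with h1 | h1 <;> rcases occ_eq_zero_or_one η b with h2 | h2
  · exact htriv (by rw [interchange_eq_self (h1.trans h2.symm)])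
  · rw [interchange_comm]; exact key b a η h2 h1
  · exact key a b η h1 h2
  · exact htriv (by rw [interchange_eq_self (h1.trans h2.symm)])

/-! ### Upper bounds on the distance to equilibrium -/

theorem law_act (t : ℕ) {ξ : Config n k} {σ : Equiv.Perm (Fin n)} (hσ : act σ ξ = ξ)
    (η : Config n k) : law n k t ξ (act σ η) = law n k t ξ η := by
  have hlaw : ∀ ζ : Config n k, law n k t ξ ζ = step^[t] (fun θ => if θ = ζ then 1 else 0) ξ := by
    intro ζ
    rw [← sum_law_mul]
    simp
  have hinj : ∀ θ : Config n k, act σ θ = act σ η ↔ θ = η := by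
    refine fun θ => ⟨fun e => ?_, fun e => by rw [e]⟩
    have := congrArg (act σ⁻¹) e
    rw [act_act, act_act, inv_mul_cancel] at this
    exact this
  rw [hlaw, hlaw]
  conv_lhs => rw [← hσ, step_iterate_act]
  simp only [hinj]

theorem tvDist_law_le (hn : 0 < n) {t : ℕ} {ξ : Config n k} {B : ℝ}
    (hB : ∀ f : Config n k → ℝ, (∀ η, |f η| ≤ 1) → StabInvariant ξ f →
      ∀ η, |step^[t] f η - step^[t] f ξ| ≤ B) :
    tvDist (law n k t ξ) (equilibrium n k) ≤ B / 2 := by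
  -- The optimal test function. It inherits the stabilizer symmetry of the law, so `hB` is needed
  -- only for invariant functions.
  set f : Config n k → ℝ := fun η => if equilibrium n k η ≤ law n k t ξ η then 1 else -1 with hf
  have hf1 : ∀ η, |f η| ≤ 1 := by
    intro η
    simp only [hf]
    split_ifs <;> simp
  have hinv : StabInvariant ξ f := by
    intro σ hσ η
    change (if equilibrium n k (act σ η) ≤ law n k t ξ (act σ η) then (1 : ℝ) else -1) = _
    rw [law_act t hσ]
    rfl
  have hN : (0 : ℝ) < Fintype.card (Config n k) := by
    exact_mod_cast Fintype.card_pos_iff.2 ⟨ξ⟩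
  have habs : ∀ η, |law n k t ξ η - equilibrium n k η| =
      law n k t ξ η * f η - f η * (1 / (Fintype.card (Config n k) : ℝ)) := by
    intro η
    simp only [hf]
    split_ifs with h
    · rw [abs_of_nonneg (by linarith)]
      simp [equilibrium]
    · rw [abs_of_neg (by linarith)]
      simp only [equilibrium]
      ring
  have hsum : ∑ η, |law n k t ξ η - equilibrium n k η| =
      (∑ η, (step^[t] f ξ - step^[t] f η)) / (Fintype.card (Config n k) : ℝ) := by
    simp only [habs, Finset.sum_sub_distrib, sum_law_mul, ← Finset.sum_mul,
      sum_step_iterate hn, Finset.sum_const, Finset.card_univ, nsmul_eq_mul]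
    field_simp
  have hle : ∑ η, (step^[t] f ξ - step^[t] f η) ≤ Fintype.card (Config n k) * B := by
    rw [← nsmul_eq_mul, ← Finset.card_univ]
    refine Finset.sum_le_card_nsmul _ _ _ fun η _ => ?_
    have := hB f hf1 hinv η
    rw [abs_sub_comm] at this
    exact (le_abs_self _).trans this
  rw [tvDist, hsum]
  have : (∑ η, (step^[t] f ξ - step^[t] f η)) / (Fintype.card (Config n k) : ℝ) ≤ B := by
    rw [div_le_iff₀ hN]
    linarith
  linarith

theorem one_sub_two_div_nonneg (hn : 2 ≤ n) : (0 : ℝ) ≤ 1 - 2 / n := by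
  have : (2 : ℝ) / n ≤ 1 := by
    rw [div_le_one (by positivity)]
    exact_mod_cast hn
  linarith

theorem dist_le_particles (hn : 2 ≤ n) (t : ℕ) : dist n k t ≤ k * (1 - 2 / n) ^ t := by
  have hl := one_sub_two_div_nonneg hn
  refine Real.iSup_le (fun ξ => ?_) (by positivity)
  have := tvDist_law_le (by omega : 0 < n) (t := t) (ξ := ξ) (B := 2 * (1 - 2 / n) ^ t * k) ?_
  · linarith
  · intro f hf _ η
    refine abs_sub_le_of_lipschitz (by omega) (step_iterate_lipschitz hn (fun p ζ => ?_) t) η ξ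
    have h1 := abs_le.1 (hf (interchange p ζ))
    have h2 := abs_le.1 (hf ζ)
    rw [abs_le]
    constructor <;> linarith

theorem dist_le_smoothing (hn : 2 ≤ n) (hk : 1 ≤ k) (hkn : 2 * k ≤ n) (s t : ℕ) :
    dist n k (t + s) ≤ n * √(2 / (s + 1)) * (1 - 2 / n) ^ t := by
  have hl := one_sub_two_div_nonneg hn
  have hk0 : (0 : ℝ) < k := by positivity
  refine Real.iSup_le (fun ξ => ?_) (by positivity)
  have := tvDist_law_le (by omega : 0 < n) (t := t + s) (ξ := ξ)
    -- The Lipschitz constant after smoothing is the square root of `(4/k²) n² · 2/(s+1)`; the last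
    -- factor `k` is the diameter.
    (B := 2 * n / k * √(2 / (s + 1)) * (1 - 2 / n) ^ t * k) ?_
  · refine this.trans (le_of_eq ?_)
    field_simp
  · intro f hf hinv η
    rw [Function.iterate_add_apply]
    refine abs_sub_le_of_lipschitz (by omega) (step_iterate_lipschitz hn (fun p ζ => ?_) t) η ξ
    have h1 := (hinv.step_iterate s).sq_le (by omega) hkn
      (gam_step_iterate_le_of_abs_le_one (by omega) hf s) p ζ
    refine abs_le_of_sq_le_sq ?_ (by positivity)
    rw [mul_pow, Real.sq_sqrt (by positivity), div_pow]
    have h2 := mul_le_mul_of_nonneg_left h1 (by positivity : (0 : ℝ) ≤ 4 / (k : ℝ) ^ 2)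
    calc _ = _ := by field_simp
      _ ≤ _ := h2
      _ = _ := by ring

/-! ### The second moment of the overlap and the lower bound -/

/-- The deviation of the overlap with `ξ` from its equilibrium mean. -/
def deviation (ξ η : Config n k) : ℝ := overlap ξ η - (k : ℝ) ^ 2 / n

theorem sum_increment (ξ η : Config n k) :
    ∑ p : Fin n × Fin n, (occ ξ p.1 - occ ξ p.2) * (occ η p.1 - occ η p.2) =
      2 * (n * overlap ξ η) - 2 * (k : ℝ) ^ 2 := by
  have h : ∀ x y, (occ ξ x - occ ξ y) * (occ η x - occ η y) =
      occ ξ x * occ η x + occ ξ y * occ η y - occ ξ x * occ η y - occ ξ y * occ η x :=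
    fun x y => by ring
  simp only [Fintype.sum_prod_type, h, Finset.sum_sub_distrib, Finset.sum_add_distrib,
    ← Finset.mul_sum, ← Finset.sum_mul, sum_occ, Finset.sum_const, Finset.card_univ,
    Fintype.card_fin, nsmul_eq_mul]
  simp only [overlap, mul_left_comm _ (n : ℝ), ← Finset.mul_sum]
  ring

theorem sum_increment_sq_le (ξ η : Config n k) :
    ∑ p : Fin n × Fin n, ((occ ξ p.1 - occ ξ p.2) * (occ η p.1 - occ η p.2)) ^ 2 ≤
      2 * (n * overlap ξ η) + 2 * (k : ℝ) ^ 2 := by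
  have h : ∀ x y, ((occ ξ x - occ ξ y) * (occ η x - occ η y)) ^ 2 ≤
      occ ξ x * occ η x + occ ξ y * occ η y + occ ξ x * occ η y + occ ξ y * occ η x := by
    intro x y
    rcases occ_eq_zero_or_one ξ x with h1 | h1 <;> rcases occ_eq_zero_or_one η x with h2 | h2 <;>
    rcases occ_eq_zero_or_one ξ y with h3 | h3 <;> rcases occ_eq_zero_or_one η y with h4 | h4 <;>
      rw [h1, h2, h3, h4] <;> norm_num
  rw [Fintype.sum_prod_type]
  refine (Finset.sum_le_sum fun x _ => Finset.sum_le_sum fun y _ => h x y).trans (le_of_eq ?_)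
  simp only [Finset.sum_add_distrib,
    ← Finset.mul_sum, ← Finset.sum_mul, sum_occ, Finset.sum_const, Finset.card_univ,
    Fintype.card_fin, nsmul_eq_mul]
  simp only [overlap, mul_left_comm _ (n : ℝ), ← Finset.mul_sum]
  ring

theorem deviation_interchange (ξ η : Config n k) (p : Fin n × Fin n) :
    deviation ξ (interchange p η) =
      deviation ξ η - (occ ξ p.1 - occ ξ p.2) * (occ η p.1 - occ η p.2) := by
  have := overlap_interchange ξ η p.1 p.2
  simp only [deviation]
  linarith

theorem step_deviation (hn : 0 < n) (ξ η : Config n k) :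
    step (deviation ξ) η = (1 - 2 / n) * deviation ξ η := by
  simp only [step, deviation_interchange, Finset.sum_sub_distrib, sum_increment, Finset.sum_const,
    Finset.card_univ, Fintype.card_prod, Fintype.card_fin, nsmul_eq_mul]
  simp only [deviation]
  push_cast
  field_simp

theorem step_deviation_sq_le (hn : 0 < n) (ξ η : Config n k) :
    step (fun ζ => deviation ξ ζ ^ 2) η ≤
      (1 - 4 / n) * deviation ξ η ^ 2 + 2 / n * deviation ξ η + 4 * (k : ℝ) ^ 2 / n ^ 2 := by
  have h := sum_increment_sq_le ξ η
  have e : step (fun ζ => deviation ξ ζ ^ 2) η =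
      (1 - 4 / n) * deviation ξ η ^ 2 +
        (∑ p : Fin n × Fin n, ((occ ξ p.1 - occ ξ p.2) * (occ η p.1 - occ η p.2)) ^ 2) /
          (n : ℝ) ^ 2 := by
    simp only [step, deviation_interchange, sub_sq, Finset.sum_sub_distrib, Finset.sum_add_distrib,
      ← Finset.mul_sum, sum_increment, Finset.sum_const,
      Finset.card_univ, Fintype.card_prod, Fintype.card_fin, nsmul_eq_mul]
    simp only [deviation]
    push_cast
    field_simp
    ring
  rw [e]
  have h2 := div_le_div_of_nonneg_right h (by positivity : (0 : ℝ) ≤ (n : ℝ) ^ 2)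
  have e2 : (2 * (n * overlap ξ η) + 2 * (k : ℝ) ^ 2) / (n : ℝ) ^ 2 =
      2 / n * deviation ξ η + 4 * (k : ℝ) ^ 2 / n ^ 2 := by
    simp only [deviation]
    field_simp
    ring
  linarith

theorem step_iterate_deviation (hn : 0 < n) (t : ℕ) (ξ η : Config n k) :
    step^[t] (deviation ξ) η = (1 - 2 / n) ^ t * deviation ξ η := by
  induction t generalizing η with
  | zero => simp
  | succ t ih =>
    rw [Function.iterate_succ_apply']
    have : step^[t] (deviation ξ) =
        fun ζ => (1 - 2 / n : ℝ) ^ t * deviation ξ ζ + 0 * deviation ξ ζ := by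
      funext ζ
      rw [ih, zero_mul, add_zero]
    rw [this, step_linear]
    simp only [step_deviation hn]
    ring

/-- The recursion of `step_deviation_sq_le` closes on this form because `1 - 4/n ≤ (1 - 2/n)²` and
the initial deviation is at most `k`; `4 ≤ n` keeps the factor `1 - 4/n` nonnegative. -/
theorem step_iterate_deviation_sq_le (hn : 4 ≤ n) (t : ℕ) (ξ : Config n k) :
    step^[t] (fun ζ => deviation ξ ζ ^ 2) ξ ≤
      ((1 - 2 / n) ^ t * deviation ξ ξ) ^ 2 + 2 * (k : ℝ) ^ 2 / n + 2 * k * (1 - 2 / n) ^ t := by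
  have hn0 : (0 : ℝ) < n := by positivity
  have hn4 : (4 : ℝ) ≤ n := by exact_mod_cast hn
  induction t with
  | zero =>
    simp only [Function.iterate_zero, id, pow_zero, one_mul, mul_one]
    have : (0 : ℝ) ≤ 2 * (k : ℝ) ^ 2 / n + 2 * k := by positivity
    linarith
  | succ t ih =>
    set F := deviation ξ with hF
    set l : ℝ := 1 - 2 / n with hl
    set m : ℝ := 1 / n with hm
    have hlm : l = 1 - 2 * m := by rw [hl, hm]; ring
    have hm0 : 0 < m := by positivity
    have hm4 : m ≤ 1 / 4 := by
      rw [hm]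
      exact one_div_le_one_div_of_le (by norm_num) hn4
    have hlt : 0 ≤ l ^ t := pow_nonneg (by linarith) t
    have h1 : ∀ η, step (fun ζ => F ζ ^ 2) η ≤
        (1 - 4 * m) * F η ^ 2 + 1 * (2 * m * F η + 4 * (k * m) ^ 2 * 1) := by
      intro η
      refine (step_deviation_sq_le (by omega) ξ η).trans (le_of_eq ?_)
      rw [hm]
      ring
    have h2 := step_iterate_mono h1 t ξ
    simp only [step_iterate_linear, step_iterate_const (by omega : 0 < n)] at h2
    rw [step_iterate_deviation (by omega)] at h2
    rw [Function.iterate_succ_apply, pow_succ l t]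
    have hdev : F ξ ≤ k := by
      simp only [hF, deviation, overlap_self]
      have : (0 : ℝ) ≤ (k : ℝ) ^ 2 / n := by positivity
      linarith
    have e : 2 * (k : ℝ) ^ 2 / n = 2 * k ^ 2 * m := by rw [hm]; ring
    rw [e] at ih ⊢
    have h3 := mul_le_mul_of_nonneg_left ih (by linarith : 0 ≤ 1 - 4 * m)
    have h4 : l ^ t * F ξ ≤ l ^ t * k := mul_le_mul_of_nonneg_left hdev hlt
    have h5 : 0 ≤ m * (l ^ t * k - l ^ t * F ξ) := mul_nonneg hm0.le (by linarith)
    have h6 : 0 ≤ (k * m) ^ 2 := by positivity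
    have h7 : 0 ≤ m ^ 2 * (l ^ t * F ξ) ^ 2 := by positivity
    have h8 : 0 ≤ m * (l ^ t * k) := mul_nonneg hm0.le (mul_nonneg hlt (by positivity))
    simp only [← hl, ← hF] at h2
    generalize l ^ t = Q at *
    rw [hlm]
    linarith

theorem sum_deviation_eq_zero (hn : 0 < n) (ξ : Config n k) : ∑ η, deviation ξ η = 0 := by
  have h := sum_step hn (deviation ξ)
  have hn0 : (n : ℝ) ≠ 0 := by positivity
  simp only [step_deviation hn, ← Finset.mul_sum] at h
  field_simp at h
  linarith

/-- Summing the one-step inequality over all configurations turns stationarity into a bound on the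
equilibrium variance. -/
theorem sum_deviation_sq_le (hn : 0 < n) (ξ : Config n k) :
    ∑ η, deviation ξ η ^ 2 ≤ Fintype.card (Config n k) * ((k : ℝ) ^ 2 / n) := by
  have hn0 : (0 : ℝ) < n := by positivity
  have h := Finset.sum_le_sum fun η (_ : η ∈ Finset.univ) => step_deviation_sq_le hn ξ η
  rw [sum_step hn] at h
  simp only [Finset.sum_add_distrib, ← Finset.mul_sum, sum_deviation_eq_zero hn, Finset.sum_const,
    Finset.card_univ, nsmul_eq_mul] at h
  set S := ∑ η, deviation ξ η ^ 2
  have h2 : 4 / n * S ≤ 4 / n * (Fintype.card (Config n k) * ((k : ℝ) ^ 2 / n)) := by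
    have e : 4 / n * (Fintype.card (Config n k) * ((k : ℝ) ^ 2 / n)) =
      Fintype.card (Config n k) * (4 * (k : ℝ) ^ 2 / n ^ 2) := by field_simp
    rw [e]
    linarith
  exact le_of_mul_le_mul_left h2 (by positivity)

theorem le_tvDist {Ω : Type*} [Fintype Ω] {μ ν : Ω → ℝ} (hμν : ∑ η, μ η = ∑ η, ν η)
    {g : Ω → ℝ} (h0 : ∀ η, 0 ≤ g η) (h1 : ∀ η, g η ≤ 1) :
    ∑ η, μ η * g η - ∑ η, ν η * g η ≤ tvDist μ ν := by
  have h : ∑ η, (2 * (μ η * g η - ν η * g η) - (μ η - ν η)) ≤ ∑ η, |μ η - ν η| := by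
    refine Finset.sum_le_sum fun η _ => ?_
    calc _ = (2 * g η - 1) * (μ η - ν η) := by ring
      _ ≤ |(2 * g η - 1) * (μ η - ν η)| := le_abs_self _
      _ = |2 * g η - 1| * |μ η - ν η| := abs_mul _ _
      _ ≤ 1 * |μ η - ν η| := by
        gcongr
        rw [abs_le]
        constructor <;> linarith [h0 η, h1 η]
      _ = _ := one_mul _
  rw [Finset.sum_sub_distrib, ← Finset.mul_sum, Finset.sum_sub_distrib, Finset.sum_sub_distrib,
    hμν] at h
  rw [tvDist]
  linarith

theorem exists_config (hkn : k ≤ n) : Nonempty (Config n k) := by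
  refine ⟨⟨fun x => if (x : ℕ) < k then 1 else 0, ?_⟩⟩
  have : ∀ x : Fin n, ((if (x : ℕ) < k then (1 : Fin 2) else 0 : Fin 2) : ℕ) =
      if (x : ℕ) < k then 1 else 0 := fun x => by split_ifs <;> rfl
  simp only [this]
  rw [Finset.sum_boole, Fin.card_filter_val_lt]
  simp [hkn]

theorem tvDist_law_ge (hn : 4 ≤ n) (hk : 1 ≤ k) (hkn : 2 * k ≤ n) (t : ℕ) (ξ : Config n k) :
    1 - 48 / (n * ((1 - 2 / n : ℝ) ^ t) ^ 2) - 32 / (k * (1 - 2 / n : ℝ) ^ t) ≤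
      tvDist (law n k t ξ) (equilibrium n k) := by
  have hn0 : (0 : ℝ) < n := by positivity
  have hn4 : (4 : ℝ) ≤ n := by exact_mod_cast hn
  have hk0 : (0 : ℝ) < k := by positivity
  have hkn' : (2 : ℝ) * k ≤ n := by exact_mod_cast hkn
  set l : ℝ := 1 - 2 / n with hl
  have hl0 : 0 < l := by
    have : (2 : ℝ) / n ≤ 2 / 4 := by gcongr
    rw [hl]
    linarith
  set q := l ^ t with hq
  have hq0 : 0 < q := pow_pos hl0 t
  set F := deviation ξ with hF
  set E := q * F ξ with hE
  have hFξ : (k : ℝ) / 2 ≤ F ξ := by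
    simp only [hF, deviation, overlap_self]
    have : (k : ℝ) ^ 2 / n ≤ k / 2 := by
      rw [div_le_div_iff₀ hn0 (by norm_num)]
      nlinarith
    linarith
  have hE1 : q * (k / 2) ≤ E := mul_le_mul_of_nonneg_left hFξ hq0.le
  have hE0 : 0 < E := lt_of_lt_of_le (by positivity) hE1
  have hN : (0 : ℝ) < Fintype.card (Config n k) := by
    exact_mod_cast Fintype.card_pos_iff.2 ⟨ξ⟩
  set g : Config n k → ℝ := fun η => if E / 2 ≤ F η then 1 else 0 with hg
  have hlaw1 : ∑ η, law n k t ξ η = 1 := by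
    have := sum_law_mul t ξ (fun _ => (1 : ℝ))
    rw [step_iterate_const (by omega)] at this
    simpa using this
  have heq1 : ∑ η, equilibrium n k η = 1 := by
    simp only [equilibrium, Finset.sum_const, Finset.card_univ, nsmul_eq_mul]
    field_simp
  have htv := le_tvDist (μ := law n k t ξ) (ν := equilibrium n k) (g := g)
    (hlaw1.trans heq1.symm)
    (fun η => by simp only [hg]; split_ifs <;> norm_num)
    (fun η => by simp only [hg]; split_ifs <;> norm_num)
  -- Chebyshev's inequality in pointwise form, `1 - 4 ((F - E)/E)² ≤ g`, expanded to the shape that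
  -- `step_iterate_linear` rewrites.
  have hg1 : ∀ η, 1 * ((-(4 / E ^ 2)) * F η ^ 2 + 8 / E * F η) + (-3) * 1 ≤ g η := by
    intro η
    have e : 1 * ((-(4 / E ^ 2)) * F η ^ 2 + 8 / E * F η) + (-3) * 1 =
        1 - 4 * ((F η - E) / E) ^ 2 := by
      field_simp
      ring
    rw [e]
    simp only [hg]
    split_ifs with h
    · nlinarith [sq_nonneg ((F η - E) / E)]
    · have : (F η - E) / E ≤ -1 / 2 := by
        rw [div_le_iff₀ hE0]
        linarith
      nlinarith
  have hg2 : ∀ η, g η ≤ 4 / E ^ 2 * F η ^ 2 := by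
    intro η
    have e : 4 / E ^ 2 * F η ^ 2 = (2 * F η / E) ^ 2 := by ring
    rw [e]
    simp only [hg]
    split_ifs with h
    · have : 1 ≤ 2 * F η / E := by
        rw [le_div_iff₀ hE0]
        linarith
      nlinarith
    · positivity
  have hμ : 1 - 4 / E ^ 2 * (2 * (k : ℝ) ^ 2 / n + 2 * k * q) ≤ ∑ η, law n k t ξ η * g η := by
    rw [sum_law_mul]
    refine le_trans ?_ (step_iterate_mono hg1 t ξ)
    simp only [step_iterate_linear, step_iterate_const (by omega : 0 < n)]
    rw [step_iterate_deviation (by omega)]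
    have h2 := step_iterate_deviation_sq_le hn t ξ
    simp only [← hl, ← hq, ← hF, ← hE] at h2 ⊢
    have h3 := mul_le_mul_of_nonneg_left h2 (by positivity : 0 ≤ 4 / E ^ 2)
    have e1 : 4 / E ^ 2 * (E ^ 2 + 2 * (k : ℝ) ^ 2 / n + 2 * k * q) =
        4 + 4 / E ^ 2 * (2 * (k : ℝ) ^ 2 / n + 2 * k * q) := by
      field_simp
      ring
    have e2 : 8 / E * E = 8 := by field_simp
    rw [e1] at h3
    rw [e2]
    linarith
  have hπ : ∑ η, equilibrium n k η * g η ≤ 4 / E ^ 2 * ((k : ℝ) ^ 2 / n) := by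
    calc ∑ η, equilibrium n k η * g η
        ≤ ∑ η, 1 / (Fintype.card (Config n k) : ℝ) * (4 / E ^ 2 * F η ^ 2) := by
          refine Finset.sum_le_sum fun η _ => ?_
          simp only [equilibrium]
          exact mul_le_mul_of_nonneg_left (hg2 η) (by positivity)
      _ = 4 / E ^ 2 * ((∑ η, F η ^ 2) / (Fintype.card (Config n k) : ℝ)) := by
          rw [← Finset.mul_sum, ← Finset.mul_sum]
          ring
      _ ≤ 4 / E ^ 2 * ((k : ℝ) ^ 2 / n) := by
          refine mul_le_mul_of_nonneg_left ?_ (by positivity)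
          rw [div_le_iff₀ hN, mul_comm]
          exact sum_deviation_sq_le (by omega) ξ
  have hfin : 4 / E ^ 2 * (3 * (k : ℝ) ^ 2 / n + 2 * k * q) ≤ 48 / (n * q ^ 2) + 32 / (k * q) := by
    calc 4 / E ^ 2 * (3 * (k : ℝ) ^ 2 / n + 2 * k * q)
        ≤ 4 / (q * (k / 2)) ^ 2 * (3 * (k : ℝ) ^ 2 / n + 2 * k * q) := by gcongr
      _ = 48 / (n * q ^ 2) + 32 / (k * q) := by
        field_simp
        ring
  have e3 : 4 / E ^ 2 * (3 * (k : ℝ) ^ 2 / n + 2 * k * q) =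
      4 / E ^ 2 * (2 * (k : ℝ) ^ 2 / n + 2 * k * q) + 4 / E ^ 2 * ((k : ℝ) ^ 2 / n) := by ring
  linarith

theorem dist_ge (hn : 4 ≤ n) (hk : 1 ≤ k) (hkn : 2 * k ≤ n) (t : ℕ) :
    1 - 48 / (n * ((1 - 2 / n : ℝ) ^ t) ^ 2) - 32 / (k * (1 - 2 / n : ℝ) ^ t) ≤ dist n k t := by
  obtain ⟨ξ⟩ := exists_config (by omega : k ≤ n)
  exact (tvDist_law_ge hn hk hkn t ξ).trans
    (le_ciSup (f := fun ξ : Config n k => tvDist (law n k t ξ) (equilibrium n k))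
      (Set.finite_range _).bddAbove ξ)

end

/-! ### Cutoff -/

theorem pow_le_exp {n : ℕ} (hn : 2 ≤ n) (t : ℕ) :
    (1 - 2 / n : ℝ) ^ t ≤ Real.exp (-(2 * t / n)) := by
  calc (1 - 2 / n : ℝ) ^ t ≤ Real.exp (-(2 / n)) ^ t :=
        pow_le_pow_left₀ (one_sub_two_div_nonneg hn) (Real.one_sub_le_exp_neg _) t
    _ = Real.exp (-(2 * t / n)) := by
        rw [← Real.exp_nat_mul]
        congr 1
        ring

/-- From `1 - 2/n ≥ exp(-2/(n-2))`; replacing `n - 2` by `n` costs `4t/(n(n-2))`, at most `4` for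
these `t`. -/
theorem exp_le_pow {n : ℕ} (hn : 4 ≤ n) {t : ℕ} (ht : 2 * (t : ℝ) ≤ (n : ℝ) ^ 2) :
    Real.exp (-(2 * t / n) - 4) ≤ (1 - 2 / n : ℝ) ^ t := by
  have hn4 : (4 : ℝ) ≤ n := by exact_mod_cast hn
  have hn2 : (0 : ℝ) < n - 2 := by linarith
  have hn0 : (0 : ℝ) < n := by linarith
  have h1 : Real.exp (-(2 / (n - 2))) ≤ 1 - 2 / n := by
    rw [Real.exp_neg]
    refine inv_le_of_inv_le₀ ?_ ?_
    · have : (2 : ℝ) / n ≤ 2 / 4 := by gcongr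
      linarith
    · calc (1 - 2 / n : ℝ)⁻¹ = 2 / (n - 2) + 1 := by
            have : (1 - 2 / n : ℝ) = (n - 2) / n := by field_simp
            rw [this, inv_div]
            field_simp
            ring
        _ ≤ _ := Real.add_one_le_exp _
  calc Real.exp (-(2 * t / n) - 4) ≤ Real.exp (t * -(2 / (n - 2))) := by
        rw [Real.exp_le_exp]
        have e : (t : ℝ) * -(2 / (n - 2)) = -(2 * t / n) - 4 * t / (n * (n - 2)) := by
          field_simp
          ring
        have : 4 * (t : ℝ) / (n * (n - 2)) ≤ 4 := by
          rw [div_le_iff₀ (by positivity)]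
          nlinarith
        linarith
    _ = Real.exp (-(2 / (n - 2))) ^ t := by rw [Real.exp_nat_mul]
    _ ≤ _ := pow_le_pow_left₀ (Real.exp_pos _).le h1 t

/-- The lower half of the cutoff, for a window parameter that may still be increased. -/
theorem eventually_dist_ge {k : ℕ → ℕ} {T : ℕ → ℝ}
    (hk : ∀ n : ℕ, 2 ≤ n → 1 ≤ k n ∧ 2 * k n ≤ n)
    (hT : ∀ n : ℕ, 2 ≤ n → T n ≤ 1 / 2 * n * Real.log n) {c : ℝ} (hc : 0 < c)
    (h1 : ∀ n : ℕ, 2 ≤ n → c ≤ n * Real.exp (-(2 * T n / n)) ^ 2)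
    (h2 : ∀ n : ℕ, 2 ≤ n → c ≤ k n * Real.exp (-(2 * T n / n))) {ε : ℝ} (hε : 0 < ε) :
    ∀ᶠ β : ℝ in atTop, ∀ n : ℕ, 2 ≤ n → 0 ≤ T n - β * n →
      1 - ε ≤ dist n (k n) ⌊T n - β * n⌋₊ := by
  -- Here `80 = 48 + 32` from `dist_ge`. A nonnegative time forces `2β ≤ log n ≤ n - 1`, so `β ≥ 2`
  -- excludes small `n`.
  filter_upwards [eventually_ge_atTop (2 + 80 / (c * ε))] with β hβ n hn hpos
  have hn0 : (0 : ℝ) < n := by positivity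
  have hq : (0 : ℝ) < 80 / (c * ε) := by positivity
  obtain ⟨hk1, hkn⟩ := hk n hn
  have hk0 : (0 : ℝ) < k n := by exact_mod_cast hk1
  have hlog : Real.log n ≤ n - 1 := Real.log_le_sub_one_of_pos hn0
  have hβlog : 2 * β ≤ Real.log n := by
    have : β * n ≤ 1 / 2 * Real.log n * n := by linarith [hT n hn]
    linarith [le_of_mul_le_mul_right this hn0]
  have hn4 : 4 ≤ n := by
    have : (4 : ℝ) ≤ n := by linarith
    exact_mod_cast this
  set t := ⌊T n - β * n⌋₊ with ht
  have ht1 : (t : ℝ) ≤ T n - β * n := Nat.floor_le hpos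
  have ht2 : 2 * (t : ℝ) ≤ (n : ℝ) ^ 2 := by nlinarith [hT n hn]
  set r := Real.exp (-(2 * T n / n)) with hr
  have hr0 : 0 < r := Real.exp_pos _
  set A := Real.exp (2 * β - 4) with hA
  have hA1 : 1 ≤ A := by
    rw [hA]
    exact Real.one_le_exp (by linarith)
  have hA2 : 80 / (c * ε) ≤ A := by
    rw [hA]
    linarith [Real.add_one_le_exp (2 * β - 4)]
  have hpow : r * A ≤ (1 - 2 / n : ℝ) ^ t := by
    refine le_trans ?_ (exp_le_pow hn4 ht2)
    rw [hr, hA, ← Real.exp_add, Real.exp_le_exp]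
    have : 2 * (t : ℝ) / n ≤ 2 * T n / n - 2 * β := by
      rw [div_le_iff₀ hn0, sub_mul, div_mul_cancel₀ _ hn0.ne']
      linarith
    linarith
  refine le_trans ?_ (dist_ge hn4 hk1 hkn t)
  have hb1 : 48 / (n * ((1 - 2 / n : ℝ) ^ t) ^ 2) ≤ 48 / (c * A) := by
    refine div_le_div_of_nonneg_left (by norm_num) (by positivity) ?_
    calc c * A ≤ n * r ^ 2 * A ^ 2 := by
          have : A ≤ A ^ 2 := by nlinarith
          exact mul_le_mul (h1 n hn) this (by positivity) (by positivity)
      _ = n * (r * A) ^ 2 := by ring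
      _ ≤ _ := by gcongr
  have hb2 : 32 / (k n * (1 - 2 / n : ℝ) ^ t) ≤ 32 / (c * A) := by
    refine div_le_div_of_nonneg_left (by norm_num) (by positivity) ?_
    calc c * A ≤ k n * r * A := by gcongr; exact h2 n hn
      _ = k n * (r * A) := by ring
      _ ≤ _ := by gcongr
  have hb3 : 48 / (c * A) + 32 / (c * A) ≤ ε := by
    rw [← add_div, div_le_iff₀ (by positivity)]
    rw [div_le_iff₀ (by positivity)] at hA2
    linarith
  linarith

theorem eventually_dist_le_of_sqrt {k : ℕ → ℕ} (hk : ∀ n : ℕ, 2 ≤ n → 1 ≤ k n ∧ 2 * k n ≤ n)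
    {ε : ℝ} (hε : 0 < ε) :
    ∀ᶠ β : ℝ in atTop, ∀ n : ℕ, 2 ≤ n →
      dist n (k n) ⌊1 / 4 * (n : ℝ) * Real.log n + β * n⌋₊ ≤ ε := by
  filter_upwards [eventually_ge_atTop (2 + 2 / ε ^ 2)] with β hβ n hn
  have hn0 : (0 : ℝ) < n := by positivity
  have hn2 : (2 : ℝ) ≤ n := by exact_mod_cast hn
  obtain ⟨hk1, hkn⟩ := hk n hn
  have hq : (0 : ℝ) < 2 / ε ^ 2 := by positivity
  have hlog : 0 ≤ Real.log n := Real.log_nonneg (by linarith)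
  set T := 1 / 4 * (n : ℝ) * Real.log n with hT
  have hT0 : 0 ≤ T := by positivity
  -- `t` steps contract and the remaining `s` smooth; the two roundings lose at most `2 ≤ n` steps,
  -- hence `β - 1` below.
  set t := ⌈T⌉₊ with ht
  set N := ⌊T + β * n⌋₊ with hN
  have h1 : T ≤ t := Nat.le_ceil T
  have h2 : (t : ℝ) < T + 1 := Nat.ceil_lt_add_one hT0
  have h3 : T + β * n < N + 1 := Nat.lt_floor_add_one _
  have h4 : (β - 1) * n ≤ N - t := by nlinarith
  have htN : t ≤ N := by
    have : (t : ℝ) ≤ N := by nlinarith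
    exact_mod_cast this
  obtain ⟨s, hs⟩ := Nat.exists_eq_add_of_le htN
  have hs' : (N : ℝ) - t = s := by rw [hs]; push_cast; ring
  rw [hs'] at h4
  rw [hs]
  refine (dist_le_smoothing hn hk1 hkn s t).trans ?_
  have hpow : (1 - 2 / n : ℝ) ^ t ≤ Real.exp (-(Real.log n / 2)) := by
    refine (pow_le_exp hn t).trans ?_
    rw [Real.exp_le_exp, neg_le_neg_iff, le_div_iff₀ hn0]
    linarith
  have hl := one_sub_two_div_nonneg hn
  have hsq : (n * √(2 / (s + 1)) * (1 - 2 / n : ℝ) ^ t) ^ 2 ≤ ε ^ 2 := by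
    calc (n * √(2 / (s + 1)) * (1 - 2 / n : ℝ) ^ t) ^ 2
        ≤ (n * √(2 / (s + 1)) * Real.exp (-(Real.log n / 2))) ^ 2 := by gcongr
      _ = 2 * (n : ℝ) / ((s : ℝ) + 1) := by
        rw [mul_pow, mul_pow, Real.sq_sqrt (by positivity), ← Real.exp_nat_mul]
        have : ((2 : ℕ) : ℝ) * -(Real.log n / 2) = -Real.log n := by push_cast; ring
        rw [this, Real.exp_neg, Real.exp_log hn0]
        field_simp
      _ ≤ ε ^ 2 := by
        rw [div_le_iff₀ (by positivity)]
        have h5 : 2 / ε ^ 2 * n ≤ s + 1 := by nlinarith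
        have h6 := mul_le_mul_of_nonneg_left h5 (by positivity : 0 ≤ ε ^ 2)
        calc 2 * (n : ℝ) = ε ^ 2 * (2 / ε ^ 2 * n) := by field_simp
          _ ≤ _ := h6
  exact (abs_le_of_sq_le_sq' hsq hε.le).2

theorem eventually_dist_le_of_particles {k : ℕ → ℕ}
    (hk : ∀ n : ℕ, 2 ≤ n → 1 ≤ k n ∧ 2 * k n ≤ n) {ε : ℝ} (hε : 0 < ε) :
    ∀ᶠ β : ℝ in atTop, ∀ n : ℕ, 2 ≤ n →
      dist n (k n) ⌊1 / 2 * (n : ℝ) * Real.log (k n) + β * n⌋₊ ≤ ε := by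
  filter_upwards [eventually_ge_atTop (1 / ε)] with β hβ n hn
  have hn0 : (0 : ℝ) < n := by positivity
  have hn2 : (2 : ℝ) ≤ n := by exact_mod_cast hn
  have hq : 0 < 1 / ε := by positivity
  obtain ⟨hk1, hkn⟩ := hk n hn
  have hk0 : (0 : ℝ) < k n := by exact_mod_cast hk1
  set t := ⌊1 / 2 * (n : ℝ) * Real.log (k n) + β * n⌋₊ with ht
  have h3 : 1 / 2 * (n : ℝ) * Real.log (k n) + β * n < t + 1 := Nat.lt_floor_add_one _
  calc dist n (k n) t ≤ k n * (1 - 2 / n : ℝ) ^ t := dist_le_particles hn t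
    _ ≤ k n * Real.exp (-Real.log (k n) + -(2 * β - 1)) := by
      refine mul_le_mul_of_nonneg_left ((pow_le_exp hn t).trans ?_) hk0.le
      rw [Real.exp_le_exp, ← neg_add, neg_le_neg_iff, le_div_iff₀ hn0]
      nlinarith
    _ = (Real.exp (2 * β - 1))⁻¹ := by
      rw [Real.exp_add, Real.exp_neg, Real.exp_neg, Real.exp_log hk0]
      field_simp
    _ ≤ (1 / ε)⁻¹ := by
      refine inv_anti₀ hq ?_
      linarith [Real.add_one_le_exp (2 * β - 1)]
    _ = ε := by rw [one_div, inv_inv]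

theorem cutoffAt_of_eventually {k : ℕ → ℕ} {T : ℕ → ℝ}
    (hu : ∀ ε : ℝ, 0 < ε → ∀ᶠ β : ℝ in atTop, ∀ n : ℕ, 2 ≤ n →
      dist n (k n) ⌊T n + β * n⌋₊ ≤ ε)
    (hl : ∀ ε : ℝ, 0 < ε → ∀ᶠ β : ℝ in atTop, ∀ n : ℕ, 2 ≤ n → 0 ≤ T n - β * n →
      1 - ε ≤ dist n (k n) ⌊T n - β * n⌋₊) : CutoffAt k T := by
  intro ε hε
  obtain ⟨β, hβ, h1, h2⟩ :=
    ((eventually_gt_atTop (0 : ℝ)).and ((hu ε hε).and (hl ε hε))).exists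
  exact ⟨β, hβ, fun n hn => ⟨h1 n hn, h2 n hn⟩⟩

theorem cutoffAt_sqrt {k : ℕ → ℕ} (hk : ∀ n : ℕ, 2 ≤ n → 1 ≤ k n ∧ 2 * k n ≤ n)
    (hb : BddAbove (Set.range fun n : ℕ => ((k n : ℝ) / √n)⁻¹)) :
    CutoffAt k (fun n => 1 / 4 * (n : ℝ) * Real.log n) := by
  obtain ⟨C, hC⟩ := hb
  have hexp : ∀ n : ℕ, 2 ≤ n →
      Real.exp (-(2 * (1 / 4 * (n : ℝ) * Real.log n) / n)) = (√n)⁻¹ := by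
    intro n hn
    have hn0 : (0 : ℝ) < n := by positivity
    have e : 2 * (1 / 4 * (n : ℝ) * Real.log n) / n = Real.log n / 2 := by
      field_simp
      norm_num
    rw [e, ← Real.log_sqrt hn0.le, Real.exp_neg, Real.exp_log (by positivity)]
  -- At this time the exponential is `1/√n`: the first quantity bounded by `c` equals `1`, the
  -- second is `k/√n`.
  refine cutoffAt_of_eventually (fun ε hε => eventually_dist_le_of_sqrt hk hε) fun ε hε =>
    eventually_dist_ge hk (fun n hn => ?_) (c := min 1 (|C| + 1)⁻¹) (by positivity) (fun n hn => ?_)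
      (fun n hn => ?_) hε
  · have : 0 ≤ (n : ℝ) * Real.log n :=
      mul_nonneg (Nat.cast_nonneg n) (Real.log_natCast_nonneg n)
    linarith
  · rw [hexp n hn, inv_pow, Real.sq_sqrt (Nat.cast_nonneg n), mul_inv_cancel₀ (by positivity)]
    exact min_le_left _ _
  · have hn0 : (0 : ℝ) < n := by positivity
    have hk0 : (0 : ℝ) < k n := by exact_mod_cast (hk n hn).1
    rw [hexp n hn, ← div_eq_mul_inv]
    refine (min_le_right _ _).trans (inv_le_of_inv_le₀ (by positivity) ?_)
    have := hC ⟨n, rfl⟩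
    linarith [le_abs_self C]

theorem cutoffAt_particles {k : ℕ → ℕ} (hk : ∀ n : ℕ, 2 ≤ n → 1 ≤ k n ∧ 2 * k n ≤ n)
    (hb : BddAbove (Set.range fun n : ℕ => (k n : ℝ) / √n)) :
    CutoffAt k (fun n => 1 / 2 * (n : ℝ) * Real.log (k n)) := by
  obtain ⟨C, hC⟩ := hb
  have hexp : ∀ n : ℕ, 2 ≤ n →
      Real.exp (-(2 * (1 / 2 * (n : ℝ) * Real.log (k n)) / n)) = (k n : ℝ)⁻¹ := by
    intro n hn
    have hk0 : (0 : ℝ) < k n := by exact_mod_cast (hk n hn).1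
    have e : 2 * (1 / 2 * (n : ℝ) * Real.log (k n)) / n = Real.log (k n) := by field_simp
    rw [e, Real.exp_neg, Real.exp_log hk0]
  -- Here the exponential is `1/k`, so the roles swap: the first quantity is `n/k²` and the second
  -- equals `1`.
  refine cutoffAt_of_eventually (fun ε hε => eventually_dist_le_of_particles hk hε) fun ε hε =>
    eventually_dist_ge hk (fun n hn => ?_) (c := min 1 ((|C| + 1) ^ 2)⁻¹) (by positivity)
      (fun n hn => ?_) (fun n hn => ?_) hε
  · have hk0 : (0 : ℝ) < k n := by exact_mod_cast (hk n hn).1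
    have hkn : (k n : ℝ) ≤ n := by
      have := (hk n hn).2
      exact_mod_cast (by omega : k n ≤ n)
    have := Real.log_le_log hk0 hkn
    gcongr
  · have hn0 : (0 : ℝ) < n := by positivity
    have hk0 : (0 : ℝ) < k n := by exact_mod_cast (hk n hn).1
    have h : (k n : ℝ) / √n ≤ |C| + 1 := by
      have := hC ⟨n, rfl⟩
      simp only at this
      linarith [le_abs_self C]
    refine (min_le_right _ _).trans ?_
    rw [hexp n hn]
    have e : (n : ℝ) * (k n : ℝ)⁻¹ ^ 2 = (((k n : ℝ) / √n) ^ 2)⁻¹ := by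
      rw [div_pow, Real.sq_sqrt hn0.le, inv_div, inv_pow, div_eq_mul_inv]
    rw [e]
    gcongr
  · have hk0 : (0 : ℝ) < k n := by exact_mod_cast (hk n hn).1
    rw [hexp n hn, mul_inv_cancel₀ hk0.ne']
    exact min_le_left _ _

end Exclusion

end

theorem theorem1 (k : ℕ → ℕ) (hk : ∀ n : ℕ, 2 ≤ n → 1 ≤ k n ∧ 2 * k n ≤ n) :
    (Tendsto (fun n : ℕ => (k n : ℝ) / Real.sqrt n) atTop atTop →
      Exclusion.CutoffAt k (fun n => 1 / 4 * (n : ℝ) * Real.log n)) ∧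
    (Tendsto (fun n : ℕ => (k n : ℝ) / Real.sqrt n) atTop (𝓝 0) →
      Tendsto k atTop atTop →
      Exclusion.CutoffAt k (fun n => 1 / 2 * (n : ℝ) * Real.log (k n))) ∧
    (∀ l : ℝ, 0 < l →
      Tendsto (fun n : ℕ => (k n : ℝ) / Real.sqrt n) atTop (𝓝 l) →
      Exclusion.CutoffAt k (fun n => 1 / 4 * (n : ℝ) * Real.log n) ∧
      Exclusion.CutoffAt k (fun n => 1 / 2 * (n : ℝ) * Real.log (k n))) := by
  refine ⟨fun h => ?_, fun h _ => ?_, fun l hl h => ⟨?_, ?_⟩⟩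
  · exact Exclusion.cutoffAt_sqrt hk h.inv_tendsto_atTop.bddAbove_range
  · exact Exclusion.cutoffAt_particles hk h.bddAbove_range
  · exact Exclusion.cutoffAt_sqrt hk (h.inv₀ hl.ne').bddAbove_range
  · exact Exclusion.cutoffAt_particles hk h.bddAbove_range
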